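/- Let $n$ be an even natural number and let $\{0,1\}^n_{n/2}$ be the set of binary strings of length $n$ with exactly $n/2$ ones. Let $W$ be the matrix, with rows and columns indexed by $\{0,1\}^n_{n/2}$, of the following random walk: from $\mathbf u$, choose a uniformly random perfect matching $\mathcal M$ between the $1$-coordinates and the $0$-coordinates of $\mathbf u$ and, independently, a uniformly random bit for each edge of $\mathcal M$; then flip both endpoints of every edge whose bit is $1$. The entry $W[\mathbf u,\mathbf v]$ is the probability that the resulting string is $\mathbf v$. For $0\le t\le n/2$ let $\mathcal V_{n,t}$ be the linear span of the functions $$\mathbf x\mapsto\prod_{k=1}^t (x_{p_k}-x_{q_k})$$ on $\{0,1\}^n_{n/2}$, where $p_1,\dots,p_t,q_1,\dots,q_t\in[n]$ are distinct; in particular $f_t=(x_1-x_2)(x_3-x_4)\cdots(x_{2t-1}-x_{2t})\in\mathcal V_{n,t}$. These spaces are the eigenspaces of the $(n,n/2)$ Johnson scheme: they are nonzero, pairwise orthogonal (for the uniform measure), they span all real functions on $\{0,1\}^n_{n/2}$, and for every $t$ there is a real number $\lambda_t$ such that $Wf=\lambda_t f$ for all $f\in\mathcal V_{n,t}$. Thus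 $\lambda_0,\dots,\lambda_{n/2}$ are the eigenvalues of $W$. They are bounded as follows. There is an absolute constant $\delta_0>0$ such that for every $\delta\in(0,\delta_0]$ there is a constant $c>0$, depending only on $\delta$, such that for every even $n$: 1. $\lambda_t\le \dfrac{1}{n^{ct}}$ for every integer $t$ with $1\le t\le n/2$ and $t\le n^\delta$; 2. $\lambda_t\le \dfrac{1}{2^{\,n^{c}}}$ for every integer $t$ with $n^\delta<t\le n/2$. -/

import Mathlib

namespace BalancedSlice

/-- The balanced slice: the strings of length `n` with exactly `n / 2` ones (`n` is meant to be
even). -/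
abbrev Slice (n : ℕ) : Type :=
  {x : Fin n → Bool // (Finset.univ.filter fun i => x i = true).card = n / 2}

/-- The set of coordinates where `u` is `1`. -/
abbrev Ones {n : ℕ} (u : Slice n) : Type := {i : Fin n // u.1 i = true}

/-- The set of coordinates where `u` is `0`. -/
abbrev Zeros {n : ℕ} (u : Slice n) : Type := {i : Fin n // u.1 i = false}

/-- The perfect matchings between the `1`-coordinates and the `0`-coordinates of `u`. -/
abbrev Matching {n : ℕ} (u : Slice n) : Type := Ones u ≃ Zeros u

/-- Given a matching and a bit `a k` for each matching edge `{k, M k}` (the edges are labelled by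
their endpoint `k` among the `1`-coordinates of `u`), flip in `u` both endpoints of every edge
whose bit is `1`. -/
def flipString {n : ℕ} (u : Slice n) (M : Matching u) (a : Ones u → Bool) : Fin n → Bool :=
  fun i =>
    if h : u.1 i = true then xor (u.1 i) (a ⟨i, h⟩)
    else xor (u.1 i) (a (M.symm ⟨i, Bool.eq_false_of_not_eq_true h⟩))

theorem flipString_balanced {n : ℕ} (u : Slice n) (M : Matching u) (a : Ones u → Bool) :
    (Finset.univ.filter fun i => flipString u M a i = true).card = n / 2 := by
  classical
  have key : ∀ v : Fin n → Bool, (Finset.univ.filter fun i => v i = true).card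
      = (∑ k : Ones u, if v k.1 = true then 1 else 0)
        + ∑ k : Ones u, if v (M k).1 = true then 1 else 0 := by
    intro v
    rw [Finset.card_filter, ← Fintype.sum_subtype_add_sum_subtype (fun i => u.1 i = true)]
    congr 1
    let e : Ones u ≃ {i : Fin n // ¬ u.1 i = true} :=
      M.trans (Equiv.subtypeEquivRight fun i => by simp)
    exact (Equiv.sum_comp e (fun i => if v i.1 = true then 1 else 0)).symm
  have hu := u.2
  rw [key] at hu
  rw [key]
  refine Eq.trans ?_ hu
  rw [← Finset.sum_add_distrib, ← Finset.sum_add_distrib]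
  refine Finset.sum_congr rfl fun k _ => ?_
  have h1 : flipString u M a k.1 = xor (u.1 k.1) (a k) := by
    simp [flipString, k.2]
  have h0 : u.1 (M k).1 = false := (M k).2
  have h2 : flipString u M a (M k).1 = xor (u.1 (M k).1) (a k) := by
    simp [flipString, h0]
  rw [h1, h2, h0, k.2]
  cases a k <;> simp

/-- The map `Γ`: the balanced string obtained from `u` by flipping the endpoints of the matching
edges that are selected by `a`. -/
def step {n : ℕ} (u : Slice n) (M : Matching u) (a : Ones u → Bool) : Slice n :=
  ⟨flipString u M a, flipString_balanced u M a⟩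

/-- The matrix `W` of the walk: `W u v` is the probability that `step u M a = v`, for a uniformly
random matching `M` and an independent uniformly random bit string `a`. -/
noncomputable def walk (n : ℕ) : Matrix (Slice n) (Slice n) ℝ := fun u v =>
  (Fintype.card {r : Matching u × (Ones u → Bool) // step u r.1 r.2 = v} : ℝ) /
    (Fintype.card (Matching u × (Ones u → Bool)) : ℝ)

/-- A coordinate of a balanced string, as a real number `0` or `1`. -/
def coord {n : ℕ} (i : Fin n) (x : Slice n) : ℝ := if x.1 i = true then 1 else 0

/-- The function `x ↦ ∏ k, (x_{p k} - x_{q k})` on the slice. For `p = (1, 3, …, 2t - 1)` and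
`q = (2, 4, …, 2t)` (counting coordinates from `1`) it is
`f_t = (x_1 - x_2) (x_3 - x_4) ⋯ (x_{2t-1} - x_{2t})`. -/
def pairProduct {n t : ℕ} (p q : Fin t → Fin n) : Slice n → ℝ :=
  fun x => ∏ k, (coord (p k) x - coord (q k) x)

/-- The `t`-th eigenspace of the Johnson scheme: the span of all products of `t` differences of
coordinates, over `2 t` distinct coordinates. Equivalently, the span of the images of `f_t` under
permutations of the coordinates (for `2 t ≤ n`). -/
def johnsonSpace (n t : ℕ) : Submodule ℝ (Slice n → ℝ) :=
  Submodule.span ℝ {f | ∃ p q : Fin t → Fin n,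
    Function.Injective (Sum.elim p q) ∧ f = pairProduct p q}

end BalancedSlice

/-! ### Permutations of the coordinates, orthogonality, and the symmetries that determine a pair
product. -/

namespace BalancedSlice

open Finset

/-! Write m = n/2. Counting matchings and bits gives W[u,v] = 1/(2^m C(m,d)), where d is the number
of ones of u that are zeros of v (`walk_apply`). Hence W commutes with all coordinate permutations.
A pair product changes sign under the swap of any of its pairs and is fixed by the permutations
fixing all its coordinates. Up to a scalar it is the only such function (`eq_smul_pairProduct`), so
W multiplies it by a number. The same antisymmetry makes the spaces orthogonal. Averaging a pair
product over the stabilizer of u gives m + 1 orthogonal nonzero functions of the distance to u,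
which therefore span all of them, including the point mass at u; so the spaces span everything.

Both eigenvalue estimates rest on the exact value (m+1)/4^m of the squared norm of a row of W
(`sum_walk_sq`). For large t, Cauchy-Schwarz between a row and a pair product, which is supported on
at most 2^(n-t) strings, gives λ² ≤ (m+1)/2^t (`IsWalkEigenvalue.sq_le`). For small t, the
Hilbert-Schmidt norm of W bounds dim(V_t) λ², and dim V_t ≥ C(m,t), so C(m,t) λ² ≤ √(m+1)
(`IsWalkEigenvalue.choose_mul_sq_le`). Both are used only for large n. The finitely many remaining n
are absorbed into c by the strict bound λ < 1/2 for t ≥ 1 (`IsWalkEigenvalue.lt_half`). -/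

/-- Relabelling the coordinates of a balanced string by a permutation. -/
def permute {n : ℕ} (σ : Equiv.Perm (Fin n)) : Slice n ≃ Slice n where
  toFun x := ⟨x.1 ∘ σ, by
    refine Eq.trans ?_ x.2
    exact card_bij (fun i _ => σ i) (by simp) (by simp)
      fun i hi => ⟨σ.symm i, by simpa using hi, by simp⟩⟩
  invFun x := ⟨x.1 ∘ σ.symm, by
    refine Eq.trans ?_ x.2
    exact card_bij (fun i _ => σ.symm i) (by simp) (by simp)
      fun i hi => ⟨σ i, by simpa using hi, by simp⟩⟩
  left_inv x := by ext i; simp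
  right_inv x := by ext i; simp

@[simp]
theorem permute_apply {n : ℕ} (σ : Equiv.Perm (Fin n)) (x : Slice n) (i : Fin n) :
    (permute σ x).1 i = x.1 (σ i) := rfl

@[simp]
theorem coord_permute {n : ℕ} (σ : Equiv.Perm (Fin n)) (x : Slice n) (i : Fin n) :
    coord i (permute σ x) = coord (σ i) x := rfl

theorem pairProduct_permute {n t : ℕ} (p q : Fin t → Fin n) (σ : Equiv.Perm (Fin n))
    (x : Slice n) : pairProduct p q (permute σ x) = pairProduct (σ ∘ p) (σ ∘ q) x := rfl

theorem permute_mul {n : ℕ} (σ τ : Equiv.Perm (Fin n)) (x : Slice n) :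
    permute (σ * τ) x = permute τ (permute σ x) := rfl

section Injective

variable {n t : ℕ} {p q : Fin t → Fin n} (h : Function.Injective (Sum.elim p q))
include h

theorem left_ne_right (j k : Fin t) : p j ≠ q k := fun e => by
  have := @h (Sum.inl j) (Sum.inr k) e
  simp at this

theorem left_injective : Function.Injective p := fun j k e => by
  have := @h (Sum.inl j) (Sum.inl k) e
  simpa using this

theorem right_injective : Function.Injective q := fun j k e => by
  have := @h (Sum.inr j) (Sum.inr k) e
  simpa using this

theorem pairProduct_permute_swap (k : Fin t) (x : Slice n) :
    pairProduct p q (permute (Equiv.swap (p k) (q k)) x) = -pairProduct p q x := by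
  unfold pairProduct
  rw [← mul_prod_erase univ _ (mem_univ k), ← mul_prod_erase univ _ (mem_univ k), ← neg_mul]
  congr 1
  · simp
  · refine prod_congr rfl fun j hj => ?_
    have hjk : j ≠ k := (mem_erase.1 hj).1
    simp only [coord_permute]
    rw [Equiv.swap_apply_of_ne_of_ne, Equiv.swap_apply_of_ne_of_ne]
    · exact (left_ne_right h k j).symm
    · exact fun e => hjk (right_injective h e)
    · exact fun e => hjk (left_injective h e)
    · exact left_ne_right h j k

/-- Fewer than t indices cannot meet all t disjoint pairs. Swapping the two coordinates of a missed
pair negates the pair product and fixes the monomial, so the sum is its own negative. -/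
theorem sum_pairProduct_mul_monomial {s : ℕ} (hst : s < t) (r : Fin s → Fin n) :
    ∑ x : Slice n, pairProduct p q x * ∏ k, coord (r k) x = 0 := by
  obtain ⟨k, hk⟩ : ∃ k, ∀ j, r j ≠ p k ∧ r j ≠ q k := by
    by_contra! hcon
    have hcon' : ∀ k, ∃ j, r j = p k ∨ r j = q k := fun k => by
      obtain ⟨j, hj⟩ := hcon k
      exact ⟨j, or_iff_not_imp_left.2 hj⟩
    choose c hc using hcon'
    have hinj : Function.Injective c := fun a b hab => by
      have ha := hc a
      have hb := hc b
      rw [hab] at ha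
      rcases ha with ha | ha <;> rcases hb with hb | hb
      · exact left_injective h (ha.symm.trans hb)
      · exact absurd (ha.symm.trans hb) (left_ne_right h _ _)
      · exact absurd (hb.symm.trans ha) (left_ne_right h _ _)
      · exact right_injective h (ha.symm.trans hb)
    have := Fintype.card_le_of_injective c hinj
    simp at this
    omega
  have key := Equiv.sum_comp (permute (Equiv.swap (p k) (q k)))
    (fun x => pairProduct p q x * ∏ k, coord (r k) x)
  have hr : ∀ x : Slice n, ∏ j, coord (r j) (permute (Equiv.swap (p k) (q k)) x)
      = ∏ j, coord (r j) x := fun x => prod_congr rfl fun j _ => by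
    rw [coord_permute, Equiv.swap_apply_of_ne_of_ne (hk j).1 (hk j).2]
  simp only [pairProduct_permute_swap h, hr, neg_mul, sum_neg_distrib] at key
  linarith

theorem sum_pairProduct_mul_pairProduct {s : ℕ} (hst : s < t) (p' q' : Fin s → Fin n) :
    ∑ x : Slice n, pairProduct p q x * pairProduct p' q' x = 0 := by
  -- Multiplying out gives signed monomials in s < t coordinates: A is the set of factors that
  -- contribute the `p'` coordinate.
  have hexp : ∀ x : Slice n, pairProduct p' q' x = ∑ A ∈ (univ : Finset (Fin s)).powerset,
      (∏ k ∈ univ \ A, (-1 : ℝ)) * ∏ k, coord (if k ∈ A then p' k else q' k) x := by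
    intro x
    simp only [pairProduct, sub_eq_add_neg]
    rw [prod_add]
    refine sum_congr rfl fun A _ => ?_
    rw [← prod_sdiff (subset_univ A) (f := fun k => coord (if k ∈ A then p' k else q' k) x),
      ← mul_assoc, ← prod_mul_distrib, mul_comm]
    congr 1
    · exact prod_congr rfl fun k hk => by simp [(mem_sdiff.1 hk).2]
    · exact prod_congr rfl fun k hk => by simp [hk]
  simp only [hexp, mul_sum]
  rw [sum_comm]
  refine sum_eq_zero fun A _ => ?_
  have := sum_pairProduct_mul_monomial h hst (fun k => if k ∈ A then p' k else q' k)
  rw [← mul_zero (∏ k ∈ univ \ A, (-1 : ℝ)), ← this, mul_sum]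
  exact sum_congr rfl fun x _ => by ring

end Injective

theorem sum_mul_eq_zero_of_lt {n s t : ℕ} (hst : s < t) {f g : Slice n → ℝ}
    (hf : f ∈ johnsonSpace n s) (hg : g ∈ johnsonSpace n t) : ∑ x, f x * g x = 0 := by
  induction hg using Submodule.span_induction with
  | mem g hg =>
    obtain ⟨p, q, h, rfl⟩ := hg
    induction hf using Submodule.span_induction with
    | mem f hf =>
      obtain ⟨p', q', -, rfl⟩ := hf
      simpa only [mul_comm] using sum_pairProduct_mul_pairProduct h hst p' q'
    | zero => simp
    | add a b _ _ ha hb => simp [add_mul, sum_add_distrib, ha, hb]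
    | smul c a _ ha => simp [mul_assoc, ← mul_sum, ha]
  | zero => simp
  | add a b _ _ ha hb => simp [mul_add, sum_add_distrib, ha, hb]
  | smul c a _ ha => simp [mul_left_comm _ c, ← mul_sum, ha]

theorem sum_mul_eq_zero_of_ne {n s t : ℕ} (hst : s ≠ t) {f g : Slice n → ℝ}
    (hf : f ∈ johnsonSpace n s) (hg : g ∈ johnsonSpace n t) : ∑ x, f x * g x = 0 := by
  rcases hst.lt_or_gt with h | h
  · exact sum_mul_eq_zero_of_lt h hf hg
  · simpa only [mul_comm] using sum_mul_eq_zero_of_lt h hg hf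

/-- Two colourings with equally many elements of each colour differ by a permutation. -/
theorem exists_perm_of_card_fiber_eq {α γ : Type*} [Fintype α] [DecidableEq γ] (c c' : α → γ)
    (h : ∀ y, #{i | c i = y} = #{i | c' i = y}) : ∃ σ : Equiv.Perm α, ∀ i, c (σ i) = c' i := by
  have e : ∀ y, Nonempty ({i // c' i = y} ≃ {i // c i = y}) := fun y => by
    rw [← Fintype.card_eq, Fintype.card_subtype, Fintype.card_subtype, h]
  exact ⟨Equiv.ofFiberEquiv fun y => (e y).some, fun i => Equiv.ofFiberEquiv_map _ i⟩

theorem card_filter_and_add_card_filter_and_not {α : Type*} [Fintype α] (a b : α → Bool) :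
    #{i | a i = true ∧ b i = true} + #{i | a i = true ∧ b i = false} = #{i | a i = true} := by
  classical
  rw [← card_union_of_disjoint]
  · congr 1
    ext i
    cases h : b i <;> simp [h]
  · rw [disjoint_filter]
    rintro i - ⟨_, h⟩ ⟨_, h'⟩
    simp_all

/-- The number of coordinates where `u` is `1` and `v` is `0`. -/
def dist {n : ℕ} (u v : Slice n) : ℕ := #{i | u.1 i = true ∧ v.1 i = false}

theorem dist_comm {n : ℕ} (u v : Slice n) : dist u v = dist v u := by
  have h1 := card_filter_and_add_card_filter_and_not u.1 v.1
  have h2 := card_filter_and_add_card_filter_and_not v.1 u.1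
  have h3 : #{i | u.1 i = true ∧ v.1 i = true} = #{i | v.1 i = true ∧ u.1 i = true} := by
    simp only [and_comm]
  have := u.2
  have := v.2
  simp only [dist]
  omega

theorem dist_le {n : ℕ} (u v : Slice n) : dist u v ≤ n / 2 := by
  rw [← u.2]
  exact card_le_card fun i => by simp +contextual

theorem dist_eq_zero {n : ℕ} {u v : Slice n} : dist u v = 0 ↔ u = v := by
  constructor
  · intro h
    have h' := dist_comm u v ▸ h
    simp only [dist, card_eq_zero, filter_eq_empty_iff, mem_univ, forall_const, not_and,
      Bool.not_eq_false] at h h'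
    ext i
    rw [Bool.eq_iff_iff]
    exact ⟨fun hi => h hi, fun hi => h' hi⟩
  · rintro rfl
    simp [dist]

theorem dist_permute {n : ℕ} (σ : Equiv.Perm (Fin n)) (u v : Slice n) :
    dist (permute σ u) (permute σ v) = dist u v :=
  card_bij (fun i _ => σ i) (fun i hi => mem_filter.2 ⟨mem_univ _, (mem_filter.1 hi).2⟩) (by simp)
    fun i hi => ⟨σ.symm i, mem_filter.2 ⟨mem_univ _, by simpa using hi⟩, by simp⟩

/-- The permutations act transitively on the pairs of strings at a given distance. -/
theorem exists_permute_eq_of_dist_eq {n : ℕ} {u x y : Slice n} (h : dist u x = dist u y) :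
    ∃ σ : Equiv.Perm (Fin n), permute σ u = u ∧ permute σ x = y := by
  have key : ∀ y : Slice n, #{i | u.1 i = true ∧ y.1 i = true} = n / 2 - dist u y ∧
      #{i | u.1 i = false ∧ y.1 i = true} = dist u y ∧
      #{i | u.1 i = false ∧ y.1 i = false} = n - n / 2 - dist u y := by
    intro y
    have h1 := card_filter_and_add_card_filter_and_not u.1 y.1
    have h2 : #{i | u.1 i = false ∧ y.1 i = true} = dist u y := by
      rw [dist_comm]; simp only [dist, and_comm]
    have h3 := card_filter_and_add_card_filter_and_not (fun i => !u.1 i) y.1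
    have h4 := card_filter_add_card_filter_not (s := (univ : Finset (Fin n))) fun i => u.1 i = true
    have hu := u.2
    simp only [Bool.not_eq_true', Bool.not_eq_true, card_univ, Fintype.card_fin] at h3 h4
    have : dist u y = #{i | u.1 i = true ∧ y.1 i = false} := rfl
    omega
  -- Colour a coordinate by its pair of bits; the sizes of the four classes depend only on the
  -- distance.
  obtain ⟨σ, hσ⟩ := exists_perm_of_card_fiber_eq (fun i => (u.1 i, x.1 i)) (fun i => (u.1 i, y.1 i))
    (by
      obtain ⟨a1, a2, a3⟩ := key x
      obtain ⟨b1, b2, b3⟩ := key y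
      rintro ⟨_ | _, _ | _⟩ <;> simp only [Prod.mk.injEq]
      · omega
      · omega
      · exact h
      · omega)
  simp only [Prod.mk.injEq] at hσ
  exact ⟨σ, by ext i; exact (hσ i).1, by ext i; exact (hσ i).2⟩

/-- Two balanced strings differ by a permutation that fixes the coordinates where they agree. -/
theorem exists_permute_eq_fixing {n : ℕ} (x y : Slice n) :
    ∃ σ : Equiv.Perm (Fin n), permute σ x = y ∧ ∀ i, x.1 i = y.1 i → σ i = i := by
  classical
  -- Each coordinate of agreement gets a colour of its own, which forces it to be fixed; the others
  -- are coloured by their bit, and `dist_comm` matches the class sizes.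
  obtain ⟨σ, hσ⟩ := exists_perm_of_card_fiber_eq
    (fun i => if x.1 i = y.1 i then (Sum.inl i : Fin n ⊕ Bool) else Sum.inr (x.1 i))
    (fun i => if x.1 i = y.1 i then (Sum.inl i : Fin n ⊕ Bool) else Sum.inr (y.1 i)) (by
      rintro (j | b)
      · congr 1
        ext i
        by_cases h : x.1 i = y.1 i <;> simp [h]
      · have e : ∀ (x y : Slice n) (b : Bool), #{i | (if x.1 i = y.1 i then
            (Sum.inl i : Fin n ⊕ Bool) else Sum.inr (x.1 i)) = Sum.inr b} = dist x y := by
          intro x y b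
          cases b
          · rw [dist_comm]
            simp only [dist]
            congr 1
            ext i
            cases hx : x.1 i <;> cases hy : y.1 i <;> simp [hx, hy]
          · simp only [dist]
            congr 1
            ext i
            cases hx : x.1 i <;> cases hy : y.1 i <;> simp [hx, hy]
        have e' := e y x b
        simp only [eq_comm (a := y.1 _) (b := x.1 _)] at e'
        rw [e x y b, e', dist_comm])
  have hfix : ∀ i, x.1 i = y.1 i → σ i = i := fun i hi => by
    have := hσ i
    simp only [hi, if_true] at this
    split_ifs at this
    simpa using this
  refine ⟨σ, ?_, hfix⟩
  ext i
  by_cases hi : x.1 i = y.1 i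
  · rw [permute_apply, hfix i hi, hi]
  · have := hσ i
    simp only [hi, if_false] at this
    split_ifs at this
    simpa using this

theorem exists_perm_comp_eq {α β : Type*} [Finite β] {e e' : α → β}
    (he : Function.Injective e) (he' : Function.Injective e') :
    ∃ σ : Equiv.Perm β, ∀ a, σ (e a) = e' a := by
  classical
  have := Fintype.ofFinite β
  let f : {b // b ∈ Set.range e} ≃ {b // b ∈ Set.range e'} :=
    (Equiv.ofInjective e he).symm.trans (Equiv.ofInjective e' he')
  refine ⟨f.extendSubtype, fun a => ?_⟩
  rw [Equiv.extendSubtype_apply_of_mem f (e a) ⟨a, rfl⟩]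
  simp only [f, Equiv.trans_apply]
  have : (Equiv.ofInjective e he).symm ⟨e a, ⟨a, rfl⟩⟩ = a := by
    rw [Equiv.symm_apply_eq]; rfl
  rw [this]
  rfl

/-- A function with the symmetries of `pairProduct p q` is a multiple of it. -/
theorem eq_smul_pairProduct {n t : ℕ} {p q : Fin t → Fin n} (h : Function.Injective (Sum.elim p q))
    {x₀ : Slice n} (hp : ∀ k, x₀.1 (p k) = true) (hq : ∀ k, x₀.1 (q k) = false) {g : Slice n → ℝ}
    (hswap : ∀ k x, g (permute (Equiv.swap (p k) (q k)) x) = -g x)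
    (hfix : ∀ σ : Equiv.Perm (Fin n), (∀ k, σ (p k) = p k) → (∀ k, σ (q k) = q k) →
      ∀ x, g (permute σ x) = g x) :
    g = g x₀ • pairProduct p q := by
  ext x
  rw [Pi.smul_apply, smul_eq_mul]
  induction hN : #{k | x.1 (p k) = false} using Nat.strong_induction_on generalizing x with
  | _ N ih =>
  -- If some pair has equal bits, its swap fixes x, so both antisymmetric functions vanish at x.
  by_cases hx : ∃ k, x.1 (p k) = x.1 (q k)
  · obtain ⟨k, hk⟩ := hx
    have hxx : permute (Equiv.swap (p k) (q k)) x = x := by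
      ext i
      rw [permute_apply]
      by_cases h1 : i = p k
      · simp [h1, hk]
      by_cases h2 : i = q k
      · simp [h2, hk]
      rw [Equiv.swap_apply_of_ne_of_ne h1 h2]
    have h1 := hswap k x
    have h2 := pairProduct_permute_swap h k x
    rw [hxx] at h1 h2
    have h1' : g x = 0 := by linarith
    have h2' : pairProduct p q x = 0 := by linarith
    rw [h1', h2', mul_zero]
  push Not at hx
  -- Swapping a pair oriented against `x₀` negates both sides and lowers the number of such pairs.
  by_cases hx1 : ∃ k, x.1 (p k) = false
  · obtain ⟨k, hk⟩ := hx1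
    have hlt : #{j | (permute (Equiv.swap (p k) (q k)) x).1 (p j) = false} < N := by
      rw [← hN]
      refine card_lt_card ⟨fun j => ?_, fun hsub => ?_⟩
      · intro hj
        replace hj := (mem_filter.1 hj).2
        refine mem_filter.2 ⟨mem_univ _, ?_⟩
        rw [permute_apply] at hj
        by_cases hjk : j = k
        · rw [hjk, hk]
        · rwa [Equiv.swap_apply_of_ne_of_ne (fun e => hjk (left_injective h e))
            (left_ne_right h j k)] at hj
      · have := (mem_filter.1 (hsub (mem_filter.2 ⟨mem_univ k, hk⟩))).2
        rw [permute_apply, Equiv.swap_apply_left] at this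
        exact hx k (hk.trans this.symm)
    have := ih _ hlt _ rfl
    rw [hswap, pairProduct_permute_swap h] at this
    linarith
  -- Now x agrees with `x₀` on every pair, so a permutation fixing all these coordinates carries x
  -- to `x₀`.
  · push Not at hx1
    simp only [ne_eq, Bool.not_eq_false] at hx1
    have hxq : ∀ k, x.1 (q k) = false := fun k => by
      have := hx k
      rw [hx1 k] at this
      simpa using this.symm
    obtain ⟨σ, hσ, hσ'⟩ := exists_permute_eq_fixing x x₀
    rw [← hσ, hfix σ (fun k => hσ' _ (by rw [hx1, hp])) (fun k => hσ' _ (by rw [hxq, hq]))]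
    simp [pairProduct, coord, hx1, hxq]

end BalancedSlice

/-! ### Transition probabilities of the walk and the norm of a row. -/

namespace BalancedSlice

open Finset

theorem card_ones {n : ℕ} (u : Slice n) : Fintype.card (Ones u) = n / 2 := by
  rw [Fintype.card_subtype, u.2]

theorem card_zeros {n : ℕ} (hn : Even n) (u : Slice n) : Fintype.card (Zeros u) = n / 2 := by
  have h := card_filter_add_card_filter_not (s := (univ : Finset (Fin n))) fun i => u.1 i = true
  have hu := u.2
  simp only [Bool.not_eq_true, card_univ, Fintype.card_fin] at h
  rw [Fintype.card_subtype]
  obtain ⟨m, rfl⟩ := hn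
  omega

theorem nonempty_matching {n : ℕ} (hn : Even n) (u : Slice n) : Nonempty (Matching u) := by
  rw [← Fintype.card_eq, card_ones, card_zeros hn]

theorem card_matching {n : ℕ} (hn : Even n) (u : Slice n) :
    Fintype.card (Matching u) = (n / 2).factorial := by
  rw [Fintype.card_equiv (nonempty_matching hn u).some, card_ones]

theorem card_choices {n : ℕ} (hn : Even n) (u : Slice n) :
    Fintype.card (Matching u × (Ones u → Bool)) = (n / 2).factorial * 2 ^ (n / 2) := by
  rw [Fintype.card_prod, card_matching hn, Fintype.card_fun, card_ones, Fintype.card_bool]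

theorem step_ones {n : ℕ} (u : Slice n) (M : Matching u) (a : Ones u → Bool) (i : Ones u) :
    (step u M a).1 i = !a i := by
  simp [step, flipString, i.2]

theorem step_zeros {n : ℕ} (u : Slice n) (M : Matching u) (a : Ones u → Bool) (j : Zeros u) :
    (step u M a).1 j = a (M.symm j) := by
  simp [step, flipString, j.2]

/-- After a step every edge still has one end of each value, and the bits can be read off from the
target on the ones of u. -/
theorem step_eq_iff {n : ℕ} {u v : Slice n} {M : Matching u} {a : Ones u → Bool} :
    step u M a = v ↔ (∀ i : Ones u, v.1 (M i) = !v.1 i) ∧ a = fun i : Ones u => !v.1 i := by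
  constructor
  · rintro rfl
    exact ⟨fun i => by simp [step_ones, step_zeros], by funext i; simp [step_ones]⟩
  · rintro ⟨h, rfl⟩
    ext i
    cases hi : u.1 i
    · rw [step_zeros u M _ ⟨i, hi⟩, ← h, Equiv.apply_symm_apply]
    · rw [step_ones u M _ ⟨i, hi⟩, Bool.not_not]

theorem dist_step {n : ℕ} (u : Slice n) (M : Matching u) (a : Ones u → Bool) :
    dist u (step u M a) = #{i | a i = true} := by
  refine (card_bij (fun (i : Ones u) _ => i.1) ?_ ?_ ?_).symm
  · intro i hi
    have := i.2
    simpa [step_ones, this] using hi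
  · intro i _ j _ h
    exact Subtype.ext h
  · intro i hi
    obtain ⟨hi1, hi2⟩ := (mem_filter.1 hi).2
    refine ⟨⟨i, hi1⟩, ?_, rfl⟩
    rw [step_ones u M a ⟨i, hi1⟩] at hi2
    simpa using hi2

theorem card_ones_fiber {n : ℕ} (u v : Slice n) (b : Bool) :
    Fintype.card {i : Ones u // v.1 i = b} = #{i | u.1 i = true ∧ v.1 i = b} := by
  rw [Fintype.card_congr (Equiv.subtypeSubtypeEquivSubtypeInter (fun i => u.1 i = true)
    (fun i => v.1 i = b)), Fintype.card_subtype]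

theorem card_zeros_fiber {n : ℕ} (u v : Slice n) (b : Bool) :
    Fintype.card {i : Zeros u // v.1 i = b} = #{i | u.1 i = false ∧ v.1 i = b} := by
  rw [Fintype.card_congr (Equiv.subtypeSubtypeEquivSubtypeInter (fun i => u.1 i = false)
    (fun i => v.1 i = b)), Fintype.card_subtype]

theorem card_ones_fiber_false {n : ℕ} (u v : Slice n) :
    Fintype.card {i : Ones u // v.1 i = false} = dist u v := card_ones_fiber u v false

theorem card_ones_fiber_true {n : ℕ} (u v : Slice n) :
    Fintype.card {i : Ones u // v.1 i = true} = n / 2 - dist u v := by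
  have h1 := card_filter_and_add_card_filter_and_not u.1 v.1
  have hu := u.2
  rw [card_ones_fiber]
  have : dist u v = #{i | u.1 i = true ∧ v.1 i = false} := rfl
  omega

theorem exists_matching {n : ℕ} (hn : Even n) (u v : Slice n) :
    ∃ M : Matching u, ∀ i : Ones u, v.1 (M i) = !v.1 i := by
  have e : ∀ b, Nonempty ({i : Ones u // (!v.1 i) = b} ≃ {j : Zeros u // v.1 j = b}) := by
    have h2 : Fintype.card {j : Zeros u // v.1 j = true} = dist u v := by
      rw [card_zeros_fiber, dist_comm]
      simp only [dist, and_comm]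
    have h3 : Fintype.card {j : Zeros u // v.1 j = true} +
        Fintype.card {j : Zeros u // v.1 j = false} = n / 2 := by
      have h := card_filter_add_card_filter_not (s := (univ : Finset (Zeros u)))
        fun j => v.1 j = true
      simp only [Bool.not_eq_true, card_univ] at h
      rw [Fintype.card_subtype, Fintype.card_subtype, h, card_zeros hn]
    intro b
    rw [← Fintype.card_eq]
    cases b
    · simp only [Bool.not_eq_false']
      rw [card_ones_fiber_true]
      omega
    · simp only [Bool.not_eq_true']
      rw [card_ones_fiber_false, h2]
  exact ⟨Equiv.ofFiberEquiv fun b => (e b).some, fun i => Equiv.ofFiberEquiv_map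
    (f := fun i : Ones u => !v.1 i) (g := fun j : Zeros u => v.1 j) _ i⟩

/-- Composing with one fixed compatible matching `M₀` identifies the compatible matchings with the
permutations of the ones of u that preserve the values of v; the bits are then forced. -/
theorem card_choices_step_eq {n : ℕ} (hn : Even n) (u v : Slice n) :
    Fintype.card {r : Matching u × (Ones u → Bool) // step u r.1 r.2 = v} =
      (dist u v).factorial * (n / 2 - dist u v).factorial := by
  obtain ⟨M₀, hM₀⟩ := exists_matching hn u v
  let f : Ones u → Bool := fun i => v.1 i
  let e : {r : Matching u × (Ones u → Bool) // step u r.1 r.2 = v} ≃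
      {g : Equiv.Perm (Ones u) // f ∘ g = f} :=
    { toFun := fun r => ⟨r.1.1.trans M₀.symm, by
        have h := (step_eq_iff.1 r.2).1
        funext i
        have h' := hM₀ (M₀.symm (r.1.1 i))
        rw [Equiv.apply_symm_apply, h i] at h'
        simpa [f] using h'.symm⟩
      invFun := fun g => ⟨(g.1.trans M₀, fun i => !v.1 i), step_eq_iff.2 ⟨fun i => by
        have h := congrFun g.2 i
        simp only [f, Function.comp_apply] at h
        rw [Equiv.trans_apply, hM₀, h], rfl⟩⟩
      left_inv := fun r => by
        ext1
        refine Prod.ext ?_ (step_eq_iff.1 r.2).2.symm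
        ext i
        simp
      right_inv := fun g => by
        ext i
        simp }
  rw [Fintype.card_congr e, DomMulAct.stabilizer_card, Fintype.prod_bool, mul_comm]
  congr 2
  · exact card_ones_fiber_false u v
  · exact card_ones_fiber_true u v

theorem walk_apply {n : ℕ} (hn : Even n) (u v : Slice n) :
    walk n u v = 1 / (2 ^ (n / 2) * ((n / 2).choose (dist u v) : ℝ)) := by
  have h := Nat.choose_mul_factorial_mul_factorial (dist_le u v)
  rw [walk, card_choices_step_eq hn, card_choices hn, ← h]
  have h1 := Nat.factorial_ne_zero (dist u v)
  have h2 := Nat.factorial_ne_zero (n / 2 - dist u v)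
  have h3 := (Nat.choose_pos (dist_le u v)).ne'
  push_cast
  field_simp

theorem walk_mulVec_eq_sum {n : ℕ} (f : Slice n → ℝ) (u : Slice n) :
    (walk n).mulVec f u = ∑ v, walk n u v * f v := rfl

theorem walk_mulVec_apply {n : ℕ} (hn : Even n) (f : Slice n → ℝ) (u : Slice n) :
    (walk n).mulVec f u = (∑ M : Matching u, ∑ a : Ones u → Bool, f (step u M a)) /
      ((n / 2).factorial * 2 ^ (n / 2)) := by
  rw [← Fintype.sum_prod_type' (f := fun M a => f (step u M a))]
  have hcard := card_choices hn u
  simp only [Matrix.mulVec, dotProduct, walk, Fintype.card_subtype, card_filter, hcard]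
  push_cast
  simp only [div_mul_eq_mul_div, ← sum_div, sum_mul]
  rw [sum_comm]
  simp

theorem walk_permute {n : ℕ} (hn : Even n) (σ : Equiv.Perm (Fin n)) (u v : Slice n) :
    walk n (permute σ u) (permute σ v) = walk n u v := by
  rw [walk_apply hn, walk_apply hn, dist_permute]

theorem walk_mulVec_permute {n : ℕ} (hn : Even n) (σ : Equiv.Perm (Fin n)) (f : Slice n → ℝ)
    (u : Slice n) :
    (walk n).mulVec (fun x => f (permute σ x)) u = (walk n).mulVec f (permute σ u) := by
  rw [walk_mulVec_eq_sum, walk_mulVec_eq_sum,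
    ← Equiv.sum_comp (permute σ) fun v => walk n (permute σ u) v * f v]
  exact sum_congr rfl fun v _ => by rw [walk_permute hn]

/-- The sum is W applied to its own row, that is, the mean of W[u, ·] after one step. For each
matching, the C(m,k) bit strings of weight k contribute C(m,k)/(2^m C(m,k)) = 2^(-m), for each of
the m + 1 values of k. -/
theorem sum_walk_sq {n : ℕ} (hn : Even n) (u : Slice n) :
    ∑ v, walk n u v ^ 2 = ((n / 2 : ℕ) + 1) / 4 ^ (n / 2) := by
  have hA : ∑ a : Ones u → Bool, 1 / (2 ^ (n / 2) * ((n / 2).choose #{i | a i = true} : ℝ)) =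
      ((n / 2 : ℕ) + 1) / 2 ^ (n / 2) := by
    have h1 : ∑ a : Ones u → Bool, 1 / (2 ^ (n / 2) * ((n / 2).choose #{i | a i = true} : ℝ)) =
        ∑ A ∈ (univ : Finset (Ones u)).powerset,
          1 / (2 ^ (n / 2) * ((n / 2).choose #A : ℝ)) := by
      refine sum_nbij' (fun a => ({i | a i = true} : Finset (Ones u))) (fun A i => decide (i ∈ A))
        ?_ ?_ ?_ ?_ ?_ <;> simp
    rw [h1, sum_powerset_apply_card (fun k => 1 / (2 ^ (n / 2) * ((n / 2).choose k : ℝ))),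
      card_univ, card_ones]
    rw [sum_congr rfl (g := fun _ => 1 / (2 : ℝ) ^ (n / 2))]
    · simp [div_eq_mul_inv]
    · intro k hk
      have := (Nat.choose_pos (Nat.lt_succ_iff.1 (mem_range.1 hk))).ne'
      rw [nsmul_eq_mul]
      field_simp
  have h := walk_mulVec_apply hn (fun v => walk n u v) u
  rw [walk_mulVec_eq_sum] at h
  simp only [← pow_two] at h
  have hM : ∀ M : Matching u, ∑ a : Ones u → Bool, walk n u (step u M a) =
      ((n / 2 : ℕ) + 1) / (2 : ℝ) ^ (n / 2) := fun M => by
    rw [← hA]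
    exact sum_congr rfl fun a _ => by rw [walk_apply hn, dist_step]
  rw [sum_congr rfl fun M _ => hM M, sum_const, card_univ, card_matching hn, nsmul_eq_mul] at h
  rw [h, show (4 : ℝ) = 2 * 2 by norm_num, mul_pow]
  have := Nat.factorial_ne_zero (n / 2)
  field_simp

end BalancedSlice

/-! ### Existence of the eigenvalues and completeness of the decomposition. -/

namespace BalancedSlice

open Finset

theorem nonempty_slice (n : ℕ) : Nonempty (Slice n) := by
  obtain ⟨s, -, hs⟩ := exists_subset_card_eq (s := (univ : Finset (Fin n))) (n := n / 2)
    (by rw [card_univ, Fintype.card_fin]; omega)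
  exact ⟨⟨fun i => decide (i ∈ s), by simpa using hs⟩⟩

theorem injective_elim_ones_zeros {n t : ℕ} {u : Slice n} {p : Fin t → Ones u} {q : Fin t → Zeros u}
    (hp : Function.Injective p) (hq : Function.Injective q) :
    Function.Injective (Sum.elim (fun k => (p k).1) fun k => (q k).1) :=
  (Subtype.val_injective.comp hp).sumElim (Subtype.val_injective.comp hq) fun j k h => by
    have h1 := (p j).2
    have h2 := (q k).2
    simp only [Function.comp_apply] at h
    rw [h, h2] at h1
    exact Bool.noConfusion h1

theorem exists_injective_zeros {n t : ℕ} (hn : Even n) (ht : t ≤ n / 2) (u : Slice n) :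
    ∃ q : Fin t → Zeros u, Function.Injective q := by
  obtain ⟨e⟩ := Function.Embedding.nonempty_of_card_le (α := Fin t) (β := Zeros u)
    (by rw [card_zeros hn, Fintype.card_fin]; exact ht)
  exact ⟨e, e.injective⟩

theorem exists_pairs {n t : ℕ} (hn : Even n) (ht : t ≤ n / 2) (u : Slice n) :
    ∃ p q : Fin t → Fin n, Function.Injective (Sum.elim p q) ∧ (∀ k, u.1 (p k) = true) ∧
      ∀ k, u.1 (q k) = false := by
  obtain ⟨e⟩ := Function.Embedding.nonempty_of_card_le (α := Fin t) (β := Ones u)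
    (by rw [card_ones, Fintype.card_fin]; exact ht)
  obtain ⟨q, hq⟩ := exists_injective_zeros hn ht u
  exact ⟨_, _, injective_elim_ones_zeros e.injective hq, fun k => (e k).2, fun k => (q k).2⟩

theorem pairProduct_eq_one {n t : ℕ} {u : Slice n} {p q : Fin t → Fin n}
    (hp : ∀ k, u.1 (p k) = true) (hq : ∀ k, u.1 (q k) = false) : pairProduct p q u = 1 := by
  simp [pairProduct, coord, hp, hq]

theorem pairProduct_mem {n t : ℕ} {p q : Fin t → Fin n} (h : Function.Injective (Sum.elim p q)) :
    pairProduct p q ∈ johnsonSpace n t :=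
  Submodule.subset_span ⟨p, q, h, rfl⟩

theorem injective_elim_perm {n t : ℕ} {p q : Fin t → Fin n} (h : Function.Injective (Sum.elim p q))
    (σ : Equiv.Perm (Fin n)) : Function.Injective (Sum.elim (σ ∘ p) (σ ∘ q)) := by
  rw [← Sum.comp_elim]
  exact σ.injective.comp h

theorem johnsonSpace_ne_bot {n t : ℕ} (hn : Even n) (ht : t ≤ n / 2) : johnsonSpace n t ≠ ⊥ := by
  obtain ⟨u⟩ := nonempty_slice n
  obtain ⟨p, q, h, hp, hq⟩ := exists_pairs hn ht u
  intro hbot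
  have := pairProduct_mem h
  rw [hbot, Submodule.mem_bot] at this
  have h1 := pairProduct_eq_one hp hq
  rw [this] at h1
  simp at h1

/-- The walk acts as multiplication by `μ` on the `t`-th eigenspace of the Johnson scheme. -/
def IsWalkEigenvalue (n t : ℕ) (μ : ℝ) : Prop :=
  ∀ f ∈ johnsonSpace n t, (walk n).mulVec f = μ • f

/-- Since W commutes with permutations, the image of one pair product has the symmetries required by
`eq_smul_pairProduct`. Every other generator is a permuted copy, so it has the same multiplier. -/
theorem exists_isWalkEigenvalue {n t : ℕ} (hn : Even n) (ht : t ≤ n / 2) :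
    ∃ μ, IsWalkEigenvalue n t μ := by
  obtain ⟨u⟩ := nonempty_slice n
  obtain ⟨p, q, h, hp, hq⟩ := exists_pairs hn ht u
  have key : (walk n).mulVec (pairProduct p q) =
      (walk n).mulVec (pairProduct p q) u • pairProduct p q := by
    refine eq_smul_pairProduct h hp hq (fun k x => ?_) fun σ h1 h2 x => ?_
    · rw [← walk_mulVec_permute hn]
      simp only [pairProduct_permute_swap h]
      exact congrFun (Matrix.mulVec_neg (pairProduct p q) (walk n)) x
    · rw [← walk_mulVec_permute hn]
      simp only [pairProduct_permute]
      rw [show σ ∘ p = p from funext h1, show σ ∘ q = q from funext h2]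
  refine ⟨(walk n).mulVec (pairProduct p q) u, fun f hf => ?_⟩
  induction hf using Submodule.span_induction with
  | mem f hf =>
    obtain ⟨p', q', h', rfl⟩ := hf
    obtain ⟨σ, hσ⟩ := exists_perm_comp_eq h h'
    have e : pairProduct p' q' = fun x => pairProduct p q (permute σ x) := by
      funext x
      rw [pairProduct_permute, show σ ∘ p = p' from funext fun k => hσ (Sum.inl k),
        show σ ∘ q = q' from funext fun k => hσ (Sum.inr k)]
    ext x
    rw [e, walk_mulVec_permute hn]
    exact congrFun key (permute σ x)
  | zero => rw [Matrix.mulVec_zero, smul_zero]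
  | add a b _ _ ha hb => rw [Matrix.mulVec_add, ha, hb, smul_add]
  | smul c a _ ha => rw [Matrix.mulVec_smul, ha, smul_comm]

section Span

variable {n : ℕ}

/-- The average (up to scaling) of `pairProduct p q` over the permutations that fix `u`. -/
def zonal {t : ℕ} (u : Slice n) (p q : Fin t → Fin n) : Slice n → ℝ := fun x =>
  ∑ σ : Equiv.Perm (Fin n) with permute σ u = u, pairProduct p q (permute σ x)

theorem zonal_mem {t : ℕ} (u : Slice n) {p q : Fin t → Fin n}
    (h : Function.Injective (Sum.elim p q)) : zonal u p q ∈ johnsonSpace n t := by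
  have : zonal u p q = ∑ σ : Equiv.Perm (Fin n) with permute σ u = u,
      pairProduct (σ ∘ p) (σ ∘ q) := by
    ext x
    simp [zonal, pairProduct_permute]
  rw [this]
  exact Submodule.sum_mem _ fun σ _ => pairProduct_mem (injective_elim_perm h σ)

theorem zonal_self_pos {t : ℕ} {u : Slice n} {p q : Fin t → Fin n}
    (hp : ∀ k, u.1 (p k) = true) (hq : ∀ k, u.1 (q k) = false) : 0 < zonal u p q u := by
  refine sum_pos (fun σ hσ => ?_) ⟨1, mem_filter.2 ⟨mem_univ _, rfl⟩⟩
  rw [(mem_filter.1 hσ).2, pairProduct_eq_one hp hq]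
  exact one_pos

theorem zonal_eq_of_dist_eq {t : ℕ} {u : Slice n} (p q : Fin t → Fin n) {x y : Slice n}
    (h : dist u x = dist u y) : zonal u p q x = zonal u p q y := by
  obtain ⟨τ, hτ, rfl⟩ := exists_permute_eq_of_dist_eq h
  have hτ' : permute τ⁻¹ u = u := by
    conv_lhs => rw [← hτ]
    rw [← permute_mul, mul_inv_cancel]
    rfl
  refine sum_bij' (fun σ _ => τ⁻¹ * σ) (fun σ _ => τ * σ) (fun σ hσ => ?_) (fun σ hσ => ?_)
    (fun σ _ => by simp) (fun σ _ => by simp) fun σ hσ => ?_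
  · rw [mem_filter] at hσ ⊢
    rw [permute_mul, hτ']
    exact ⟨mem_univ _, hσ.2⟩
  · rw [mem_filter] at hσ ⊢
    rw [permute_mul, hτ]
    exact ⟨mem_univ _, hσ.2⟩
  · rw [← permute_mul, mul_inv_cancel_left]

theorem linearIndependent_of_orthogonal {ι α : Type*} [Fintype ι] [Fintype α] (z : ι → α → ℝ)
    (u : α) (hz : ∀ i, z i u ≠ 0) (horth : ∀ i j, i ≠ j → ∑ x, z i x * z j x = 0) :
    LinearIndependent ℝ z := by
  rw [Fintype.linearIndependent_iff]
  intro c hc j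
  have h1 : ∑ x, (∑ t, c t • z t) x * z j x = 0 := by
    simp only [hc, Pi.zero_apply, zero_mul, sum_const_zero]
  simp only [Finset.sum_apply, Pi.smul_apply, smul_eq_mul, sum_mul] at h1
  rw [sum_comm, sum_eq_single j] at h1
  · simp only [mul_assoc, ← mul_sum] at h1
    refine (mul_eq_zero.1 h1).resolve_right (ne_of_gt ?_)
    exact sum_pos' (fun x _ => mul_self_nonneg _) ⟨u, mem_univ u, mul_self_pos.2 (hz j)⟩
  · intro t _ htj
    simp only [mul_assoc, ← mul_sum]
    rw [horth t j htj, mul_zero]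
  · simp

/-- The functions descend along d to |κ| independent functions on κ, which span by a dimension
count; pull back. -/
theorem comp_mem_span_of_factorsThrough {κ α : Type*} [Fintype κ] {z : κ → α → ℝ} {d : α → κ}
    (hz : LinearIndependent ℝ z) (hd : ∀ t x y, d x = d y → z t x = z t y) (φ : κ → ℝ) :
    φ ∘ d ∈ Submodule.span ℝ (Set.range z) := by
  -- The value 0 off the range of d is arbitrary; independence is inherited from the pullback.
  let g : κ → κ → ℝ := fun t => Function.extend d (z t) 0
  have hg : ⇑(LinearMap.funLeft ℝ ℝ d) ∘ g = z := by
    funext t x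
    exact Function.FactorsThrough.extend_apply (fun a b hab => hd t a b hab) _ x
  have hgi : LinearIndependent ℝ g :=
    LinearIndependent.of_comp (LinearMap.funLeft ℝ ℝ d) (by rwa [hg])
  have hspan := hgi.span_eq_top_of_card_eq_finrank' (by simp)
  have hmem : φ ∈ Submodule.span ℝ (Set.range g) := by
    rw [hspan]
    exact Submodule.mem_top
  have hmap := Submodule.mem_map_of_mem (f := LinearMap.funLeft ℝ ℝ d) hmem
  rw [Submodule.map_span, ← Set.range_comp, hg] at hmap
  exact hmap

theorem single_mem_iSup_johnsonSpace (hn : Even n) (u : Slice n) :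
    (Pi.single u 1 : Slice n → ℝ) ∈ ⨆ t : Fin (n / 2 + 1), johnsonSpace n t := by
  choose p q h hp hq using fun t : Fin (n / 2 + 1) => exists_pairs hn (Nat.lt_succ_iff.1 t.2) u
  have hz : LinearIndependent ℝ fun t => zonal u (p t) (q t) :=
    linearIndependent_of_orthogonal _ u (fun t => (zonal_self_pos (hp t) (hq t)).ne')
      fun s t hst => sum_mul_eq_zero_of_ne (fun e => hst (Fin.ext e)) (zonal_mem u (h s))
        (zonal_mem u (h t))
  have hmem := comp_mem_span_of_factorsThrough hz
    (d := fun x => ⟨dist u x, Nat.lt_succ_of_le (dist_le u x)⟩)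
    (fun t x y hxy => zonal_eq_of_dist_eq _ _ (congrArg Fin.val hxy)) (Pi.single 0 1)
  have hsingle : (Pi.single u 1 : Slice n → ℝ) =
      (Pi.single 0 1 : Fin (n / 2 + 1) → ℝ) ∘
        fun x => ⟨dist u x, Nat.lt_succ_of_le (dist_le u x)⟩ := by
    funext x
    rw [Function.comp_apply, Pi.single_apply, Pi.single_apply]
    exact if_congr (eq_comm.trans (dist_eq_zero.symm.trans (by simp [Fin.ext_iff]))) rfl rfl
  rw [hsingle]
  refine Submodule.span_le.2 ?_ hmem
  rintro _ ⟨t, rfl⟩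
  exact Submodule.mem_iSup_of_mem t (zonal_mem u (h t))

theorem iSup_johnsonSpace (hn : Even n) :
    (⨆ t : Fin (n / 2 + 1), johnsonSpace n t) = ⊤ := by
  refine eq_top_iff.2 fun f _ => ?_
  rw [← univ_sum_single f]
  refine Submodule.sum_mem _ fun u _ => ?_
  have := Submodule.smul_mem _ (f u) (single_mem_iSup_johnsonSpace hn u)
  rwa [← Pi.single_smul, smul_eq_mul, mul_one] at this

end Span

end BalancedSlice

/-! ### Two pointwise eigenvalue bounds: a strict 1/2, and exponential decay in t. -/

namespace BalancedSlice

open Finset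

theorem abs_coord_sub_coord_le_one {n : ℕ} (i j : Fin n) (x : Slice n) :
    |coord i x - coord j x| ≤ 1 := by
  unfold coord
  split_ifs <;> simp

theorem abs_pairProduct_le {n t : ℕ} (p q : Fin t → Fin n) (x : Slice n) (k : Fin t) :
    |pairProduct p q x| ≤ |coord (p k) x - coord (q k) x| := by
  rw [pairProduct, abs_prod, ← mul_prod_erase univ _ (mem_univ k)]
  exact mul_le_of_le_one_right (abs_nonneg _)
    (prod_le_one (fun _ _ => abs_nonneg _) fun j _ => abs_coord_sub_coord_le_one _ _ _)

section Flip

variable {α : Type*} [DecidableEq α]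

/-- Negate one bit of a bit string. -/
def flipBit (i : α) : (α → Bool) ≃ (α → Bool) :=
  Function.Involutive.toPerm (fun a => Function.update a i (!a i)) fun a => by simp

theorem flipBit_self (i : α) (a : α → Bool) : flipBit i a i = !a i := Function.update_self ..

theorem flipBit_of_ne {i j : α} (h : j ≠ i) (a : α → Bool) : flipBit i a j = a j :=
  Function.update_of_ne h ..

theorem two_mul_sum_eq_sum_add_flipBit [Fintype α] (i : α) (h : (α → Bool) → ℝ) :
    2 * ∑ a, h a = ∑ a, (h a + h (flipBit i a)) := by
  rw [sum_add_distrib, Equiv.sum_comp (flipBit i) h, two_mul]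

end Flip

/-- At a string u where the pair product is 1, the eigenvalue is the mean of the pair product after
one step. If the matching joins the first pair, flipping the bit of that edge negates the product,
so the mean over bits is 0; otherwise it is at most 1/2. Strictness comes from the matchings of the
first kind. -/
theorem IsWalkEigenvalue.lt_half {n t : ℕ} {μ : ℝ} (hμ : IsWalkEigenvalue n t μ) (hn : Even n)
    (ht : t ≤ n / 2) (ht0 : 1 ≤ t) : μ < 1 / 2 := by
  obtain ⟨u⟩ := nonempty_slice n
  obtain ⟨p, q, h, hp, hq⟩ := exists_pairs hn ht u
  let k : Fin t := ⟨0, ht0⟩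
  let i : Ones u := ⟨p k, hp k⟩
  let j : Zeros u := ⟨q k, hq k⟩
  have hsum := congrFun (hμ _ (pairProduct_mem h)) u
  rw [walk_mulVec_apply hn, Pi.smul_apply, pairProduct_eq_one hp hq, smul_eq_mul, mul_one] at hsum
  have hcardB : Fintype.card (Ones u → Bool) = 2 ^ (n / 2) := by
    rw [Fintype.card_fun, card_ones, Fintype.card_bool]
  have hmatched : ∀ M : Matching u, M i = j →
      ∑ a : Ones u → Bool, pairProduct p q (step u M a) = 0 := by
    intro M hM
    have hflip : ∀ a, step u M (flipBit i a) =
        permute (Equiv.swap (p k) (q k)) (step u M a) := by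
      intro a
      ext l
      rw [permute_apply]
      by_cases h1 : l = p k
      · rw [h1, Equiv.swap_apply_left]
        have e1 := step_ones u M (flipBit i a) i
        have e2 := step_zeros u M a j
        rw [← hM, Equiv.symm_apply_apply, hM] at e2
        rw [flipBit_self, Bool.not_not] at e1
        exact e1.trans e2.symm
      by_cases h2 : l = q k
      · rw [h2, Equiv.swap_apply_right]
        have e1 := step_ones u M a i
        have e2 := step_zeros u M (flipBit i a) j
        rw [← hM, Equiv.symm_apply_apply, hM, flipBit_self] at e2
        exact e2.trans e1.symm
      rw [Equiv.swap_apply_of_ne_of_ne h1 h2]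
      cases hl : u.1 l
      · rw [step_zeros u M _ ⟨l, hl⟩, step_zeros u M _ ⟨l, hl⟩, flipBit_of_ne]
        intro e
        rw [Equiv.symm_apply_eq, hM] at e
        exact h2 (congrArg Subtype.val e)
      · rw [step_ones u M _ ⟨l, hl⟩, step_ones u M _ ⟨l, hl⟩, flipBit_of_ne]
        exact fun e => h1 (congrArg Subtype.val e)
    have := two_mul_sum_eq_sum_add_flipBit i fun a => pairProduct p q (step u M a)
    simp only [hflip, pairProduct_permute_swap h, add_neg_cancel, sum_const_zero] at this
    linarith
  have hle : ∀ M : Matching u,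
      ∑ a : Ones u → Bool, pairProduct p q (step u M a) ≤ 2 ^ (n / 2) / 2 := by
    intro M
    by_cases hM : M i = j
    · rw [hmatched M hM]
      positivity
    have hne : M.symm j ≠ i := fun e => hM (by rw [← e, Equiv.apply_symm_apply])
    -- Flipping the bit at i changes only one coordinate of the pair, so their difference is nonzero
    -- for exactly one of the two bit strings.
    have hpair : ∀ a, pairProduct p q (step u M a) +
        pairProduct p q (step u M (flipBit i a)) ≤ 1 := by
      intro a
      have b1 := (le_abs_self _).trans (abs_pairProduct_le p q (step u M a) k)
      have b2 := (le_abs_self _).trans (abs_pairProduct_le p q (step u M (flipBit i a)) k)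
      have e1 : (step u M a).1 (p k) = !a i := step_ones u M a i
      have e2 : (step u M a).1 (q k) = a (M.symm j) := step_zeros u M a j
      have e3 : (step u M (flipBit i a)).1 (p k) = !flipBit i a i := step_ones u M _ i
      have e4 : (step u M (flipBit i a)).1 (q k) = flipBit i a (M.symm j) := step_zeros u M _ j
      rw [flipBit_self] at e3
      rw [flipBit_of_ne hne] at e4
      refine (add_le_add b1 b2).trans ?_
      simp only [coord, e1, e2, e3, e4]
      cases a i <;> cases a (M.symm j) <;> simp
    have h2 := two_mul_sum_eq_sum_add_flipBit i fun a => pairProduct p q (step u M a)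
    have h3 := sum_le_card_nsmul univ _ 1 fun a _ => hpair a
    rw [card_univ, hcardB, nsmul_eq_mul, mul_one] at h3
    push_cast at h3
    linarith
  obtain ⟨M₀⟩ := nonempty_matching hn u
  have hlt : ∑ M : Matching u, ∑ a : Ones u → Bool, pairProduct p q (step u M a) <
      ∑ _M : Matching u, (2 : ℝ) ^ (n / 2) / 2 := by
    -- Any matching composed with a transposition of zeros yields one containing the edge from i to
    -- j.
    refine sum_lt_sum (fun M _ => hle M) ⟨M₀.trans (Equiv.swap (M₀ i) j), mem_univ _, ?_⟩
    rw [hmatched _ (by simp)]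
    positivity
  rw [sum_const, card_univ, card_matching hn, nsmul_eq_mul] at hlt
  have hpos : (0 : ℝ) < (n / 2).factorial * 2 ^ (n / 2) := by
    have := Nat.factorial_pos (n / 2)
    positivity
  rw [← hsum, div_lt_iff₀ hpos]
  linarith

/-- The bit at each `q k` is the negation of the bit at `p k`, so the n - t coordinates outside q
determine the string. -/
theorem card_separating_le {n t : ℕ} {p q : Fin t → Fin n}
    (h : Function.Injective (Sum.elim p q)) :
    #{x : Slice n | ∀ k, x.1 (p k) ≠ x.1 (q k)} ≤ 2 ^ (n - t) := by
  have hc : Fintype.card {i // i ∉ univ.image q} = n - t := by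
    rw [Fintype.card_subtype, filter_not, card_sdiff_of_subset (by simp)]
    rw [filter_mem_eq_inter, univ_inter, card_image_of_injective _ (right_injective h)]
    simp
  have : 2 ^ (n - t) = Fintype.card ({i // i ∉ univ.image q} → Bool) := by
    rw [Fintype.card_fun, hc, Fintype.card_bool]
  rw [this, ← card_univ]
  refine card_le_card_of_injOn (fun x i => x.1 i.1) (fun _ _ => mem_univ _) ?_
  intro x hx y hy hxy
  have hx' := (mem_filter.1 hx).2
  have hy' := (mem_filter.1 hy).2
  have hout : ∀ i, i ∉ univ.image q → x.1 i = y.1 i := fun i hi => congrFun hxy ⟨i, hi⟩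
  ext i
  by_cases hi : i ∈ univ.image q
  · obtain ⟨k, -, rfl⟩ := mem_image.1 hi
    have h1 := hx' k
    have h2 := hy' k
    have h3 := hout (p k) fun hk => by
      obtain ⟨l, -, hl⟩ := mem_image.1 hk
      exact left_ne_right h k l hl.symm
    rw [h3] at h1
    revert h1 h2
    cases x.1 (q k) <;> cases y.1 (q k) <;> cases y.1 (p k) <;> simp
  · exact hout i hi

/-- Cauchy-Schwarz for the row of W at a string where the pair product is 1; the pair product is
bounded by 1 and supported on the strings separating every pair. -/
theorem IsWalkEigenvalue.sq_le {n t : ℕ} {μ : ℝ} (hμ : IsWalkEigenvalue n t μ) (hn : Even n)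
    (ht : t ≤ n / 2) : μ ^ 2 ≤ ((n / 2 : ℕ) + 1) / 2 ^ t := by
  obtain ⟨u⟩ := nonempty_slice n
  obtain ⟨p, q, h, hp, hq⟩ := exists_pairs hn ht u
  have hsum := congrFun (hμ _ (pairProduct_mem h)) u
  rw [walk_mulVec_eq_sum, Pi.smul_apply, pairProduct_eq_one hp hq, smul_eq_mul, mul_one] at hsum
  have hcs := sum_mul_sq_le_sq_mul_sq univ (fun v => walk n u v) (pairProduct p q)
  rw [hsum, sum_walk_sq hn] at hcs
  have hf : ∑ x : Slice n, pairProduct p q x ^ 2 ≤ 2 ^ (n - t) := by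
    have h1 : ∑ x : Slice n, pairProduct p q x ^ 2 ≤
        #{x : Slice n | ∀ k, x.1 (p k) ≠ x.1 (q k)} := by
      rw [card_filter, Nat.cast_sum]
      refine sum_le_sum fun x _ => ?_
      split_ifs with hx
      · rw [Nat.cast_one, sq_le_one_iff_abs_le_one, pairProduct, abs_prod]
        exact prod_le_one (fun _ _ => abs_nonneg _) fun k _ => abs_coord_sub_coord_le_one _ _ _
      · push Not at hx
        obtain ⟨k, hk⟩ := hx
        rw [pairProduct, prod_eq_zero (mem_univ k) (by simp [coord, hk])]
        simp
    exact h1.trans (by exact_mod_cast card_separating_le h)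
  have hpow : (4 : ℝ) ^ (n / 2) = 2 ^ (n - t) * 2 ^ t := by
    obtain ⟨m, rfl⟩ := hn
    rw [← pow_add, show (4 : ℝ) = 2 ^ 2 by norm_num, ← pow_mul]
    congr 1
    omega
  refine (hcs.trans (mul_le_mul_of_nonneg_left hf (by positivity))).trans (le_of_eq ?_)
  rw [hpow]
  field_simp

end BalancedSlice

/-! ### Dimension of the eigenspaces and the Hilbert-Schmidt bound. -/

namespace BalancedSlice

open Finset

/-- A set of at most `n / 2` ones can be kept while zeroing the others, at the expense of the zeros
outside a given set of the same size. -/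
theorem exists_slice_eq_on {n t : ℕ} (hn : Even n) (u : Slice n) (T : Finset (Ones u))
    (hT : #T = t) {q : Fin t → Zeros u} (hq : Function.Injective q) :
    ∃ x : Slice n, (∀ i : Ones u, x.1 i = true ↔ i ∈ T) ∧ ∀ k, x.1 (q k) = false := by
  let A : Finset (Fin n) := T.map (Function.Embedding.subtype _)
  let B : Finset (Fin n) := (univ \ univ.image q).map (Function.Embedding.subtype _)
  have hA : ∀ i, i ∈ A → u.1 i = true := fun i hi => by
    obtain ⟨j, -, rfl⟩ := mem_map.1 hi
    exact j.2
  have hB : ∀ i, i ∈ B → u.1 i = false := fun i hi => by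
    obtain ⟨j, -, rfl⟩ := mem_map.1 hi
    exact j.2
  have hdisj : Disjoint A B := disjoint_left.2 fun i h1 h2 => by
    have := hA i h1
    rw [hB i h2] at this
    exact Bool.noConfusion this
  have hcard : #(A ∪ B) = n / 2 := by
    have ht : t ≤ n / 2 := by
      rw [← hT, ← card_ones u]
      exact card_le_univ T
    rw [card_union_of_disjoint hdisj, card_map, card_map, hT,
      card_sdiff_of_subset (subset_univ _), card_univ, card_zeros hn,
      card_image_of_injective _ hq, card_univ, Fintype.card_fin]
    omega
  refine ⟨⟨fun i => decide (i ∈ A ∪ B), by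
    simpa only [decide_eq_true_iff, filter_univ_mem] using hcard⟩, fun i => ?_, fun k => ?_⟩
  · rw [decide_eq_true_iff, mem_union]
    constructor
    · rintro (h | h)
      · obtain ⟨j, hj, hji⟩ := mem_map.1 h
        rwa [← Subtype.ext hji]
      · have := hB _ h
        rw [i.2] at this
        exact Bool.noConfusion this
    · exact fun h => Or.inl (mem_map.2 ⟨i, h, rfl⟩)
  · rw [decide_eq_false_iff_not, mem_union]
    rintro (h | h)
    · have := hA _ h
      rw [(q k).2] at this
      exact Bool.noConfusion this
    · obtain ⟨j, hj, hjk⟩ := mem_map.1 h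
      rw [show j = q k from Subtype.ext hjk] at hj
      exact (mem_sdiff.1 hj).2 (mem_image_of_mem q (mem_univ k))

/-- Fix t zeros q of u and let the `p` side range over the t-subsets T of its ones. The string `x T`
has exactly T as its ones among those of u and vanishes on q, so the pair product of S takes the
value 1 at `x S` and 0 at `x T` for T ≠ S. -/
theorem choose_le_finrank_johnsonSpace {n t : ℕ} (hn : Even n) (ht : t ≤ n / 2) :
    (n / 2).choose t ≤ Module.finrank ℝ (johnsonSpace n t) := by
  obtain ⟨u⟩ := nonempty_slice n
  obtain ⟨q, hq⟩ := exists_injective_zeros hn ht u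
  let e : ∀ T : {T : Finset (Ones u) // #T = t}, Fin t ≃ T.1 :=
    fun T => (T.1.equivFinOfCardEq T.2).symm
  let f : {T : Finset (Ones u) // #T = t} → johnsonSpace n t := fun T =>
    ⟨pairProduct (fun k => ((e T k).1).1) (fun k => (q k).1),
      pairProduct_mem (injective_elim_ones_zeros (p := fun k => (e T k).1)
        (Subtype.val_injective.comp (e T).injective) hq)⟩
  choose x hx hxq using fun T : {T : Finset (Ones u) // #T = t} =>
    exists_slice_eq_on hn u T.1 T.2 hq
  have hself : ∀ T, (f T).1 (x T) = 1 := fun T =>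
    pairProduct_eq_one (fun k => (hx T _).2 (e T k).2) (hxq T)
  have hne : ∀ S T, S ≠ T → (f S).1 (x T) = 0 := by
    intro S T hST
    obtain ⟨i, hiS, hiT⟩ : ∃ i ∈ S.1, i ∉ T.1 := by
      by_contra! hcon
      exact hST (Subtype.ext (eq_of_subset_of_card_le hcon (by rw [S.2, T.2])))
    refine prod_eq_zero (mem_univ ((e S).symm ⟨i, hiS⟩)) ?_
    have h1 : (x T).1 i.1 = false := by
      rw [← Bool.not_eq_true, hx T i]
      exact hiT
    simp only [Equiv.apply_symm_apply, coord, h1, hxq T]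
    simp
  have hli : LinearIndependent ℝ f := by
    rw [Fintype.linearIndependent_iff]
    intro c hc T
    have h1 := congrFun (congrArg Subtype.val hc) (x T)
    simp only [Submodule.coe_sum, Submodule.coe_smul, Finset.sum_apply, Pi.smul_apply, smul_eq_mul,
      ZeroMemClass.coe_zero, Pi.zero_apply] at h1
    rw [sum_eq_single T (fun S _ hS => by rw [hne S T hS, mul_zero]) (by simp), hself,
      mul_one] at h1
    exact h1
  have := hli.fintype_card_le_finrank
  rwa [Fintype.card_finset_len, card_ones] at this

theorem card_slice (n : ℕ) : Fintype.card (Slice n) = n.choose (n / 2) := by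
  have h := Fintype.card_finset_len (α := Fin n) (n / 2)
  rw [Fintype.card_fin] at h
  rw [← h]
  exact Fintype.card_congr
    { toFun := fun x => ⟨({i | x.1 i = true} : Finset _), by simpa using x.2⟩
      invFun := fun s => ⟨fun i => decide (i ∈ s.1), by simpa using s.2⟩
      left_inv := fun x => by ext i; simp
      right_inv := fun s => by ext i; simp }

/-- An orthonormal basis of the eigenspace has inner products μ v_i(u) with the row at u. Bessel
bounds their squares by the squared norm of the row; summing over u replaces each v_i(u)² by 1. -/
theorem IsWalkEigenvalue.finrank_mul_sq_le {n t : ℕ} {μ : ℝ} (hμ : IsWalkEigenvalue n t μ)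
    (hn : Even n) : Module.finrank ℝ (johnsonSpace n t) * μ ^ 2 ≤
      n.choose (n / 2) * (((n / 2 : ℕ) + 1) / 4 ^ (n / 2)) := by
  let L := (WithLp.linearEquiv 2 ℝ (Slice n → ℝ)).symm
  let V : Submodule ℝ (EuclideanSpace ℝ (Slice n)) := (johnsonSpace n t).map L.toLinearMap
  have hV : Module.finrank ℝ V = Module.finrank ℝ (johnsonSpace n t) :=
    LinearEquiv.finrank_map_eq L _
  let b := stdOrthonormalBasis ℝ V
  let v : Fin (Module.finrank ℝ V) → EuclideanSpace ℝ (Slice n) :=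
    fun i => (b i : EuclideanSpace ℝ (Slice n))
  have hv : Orthonormal ℝ v := b.orthonormal.comp_linearIsometry V.subtypeₗᵢ
  let w : Slice n → EuclideanSpace ℝ (Slice n) := fun u => WithLp.toLp 2 fun y => walk n u y
  have hw : ∀ u, ‖w u‖ ^ 2 = ((n / 2 : ℕ) + 1) / 4 ^ (n / 2) := fun u => by
    rw [EuclideanSpace.real_norm_sq_eq, ← sum_walk_sq hn u]
  have hinner : ∀ u i, inner ℝ (v i) (w u) = μ * v i u := by
    intro u i
    obtain ⟨f, hf, hfi⟩ := (b i).2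
    have h1 : ∀ x, v i x = f x := fun x => by
      change (b i).1 x = f x
      rw [← hfi]
      rfl
    have h2 := congrFun (hμ f hf) u
    rw [walk_mulVec_eq_sum, Pi.smul_apply, smul_eq_mul] at h2
    rw [h1, ← h2, PiLp.inner_apply]
    refine sum_congr rfl fun x _ => ?_
    rw [h1]
    simp [w]
  have hbessel : ∀ u, ∑ i, (μ * v i u) ^ 2 ≤ ((n / 2 : ℕ) + 1) / 4 ^ (n / 2) := fun u => by
    have := hv.sum_inner_products_le (s := univ) (w u)
    simpa only [hinner, Real.norm_eq_abs, sq_abs, hw] using this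
  have hsum := sum_le_card_nsmul univ _ _ fun u _ => hbessel u
  rw [card_univ, card_slice, nsmul_eq_mul, sum_comm] at hsum
  refine le_trans (le_of_eq ?_) hsum
  have h1 : ∀ i, ∑ u, (μ * v i u) ^ 2 = μ ^ 2 := fun i => by
    simp only [mul_pow, ← mul_sum]
    rw [← EuclideanSpace.real_norm_sq_eq, hv.1 i]
    simp
  simp only [h1, sum_const, card_univ, Fintype.card_fin, nsmul_eq_mul, hV]

/-- The induction step is (2m+1)(2m+3) ≤ (2m+2)². This supplies the factor of order 1/√m that
reduces m + 1 to √(m+1) in the next bound. -/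
theorem sq_centralBinom_mul_le (m : ℕ) : m.centralBinom ^ 2 * (2 * m + 1) ≤ 16 ^ m := by
  induction m with
  | zero => simp
  | succ m ih =>
    have h := Nat.succ_mul_centralBinom_succ m
    have h2 : (m + 1) ^ 2 * ((m + 1).centralBinom ^ 2 * (2 * (m + 1) + 1)) ≤
        (m + 1) ^ 2 * 16 ^ (m + 1) := by
      calc (m + 1) ^ 2 * ((m + 1).centralBinom ^ 2 * (2 * (m + 1) + 1))
          = ((m + 1) * (m + 1).centralBinom) ^ 2 * (2 * m + 3) := by ring
        _ = (m.centralBinom ^ 2 * (2 * m + 1)) * (4 * (2 * m + 1) * (2 * m + 3)) := by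
          rw [h]; ring
        _ ≤ 16 ^ m * (16 * (m + 1) ^ 2) := Nat.mul_le_mul ih (by nlinarith)
        _ = (m + 1) ^ 2 * 16 ^ (m + 1) := by ring
    exact Nat.le_of_mul_le_mul_left h2 (by positivity)

theorem IsWalkEigenvalue.choose_mul_sq_le {n t : ℕ} {μ : ℝ} (hμ : IsWalkEigenvalue n t μ)
    (hn : Even n) (ht : t ≤ n / 2) :
    (n / 2).choose t * μ ^ 2 ≤ √((n / 2 : ℕ) + 1) := by
  have h1 : ((n / 2).choose t : ℝ) ≤ Module.finrank ℝ (johnsonSpace n t) := by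
    exact_mod_cast choose_le_finrank_johnsonSpace hn ht
  refine ((mul_le_mul_of_nonneg_right h1 (sq_nonneg μ)).trans (hμ.finrank_mul_sq_le hn)).trans ?_
  obtain ⟨m, rfl⟩ := hn
  rw [show (m + m) / 2 = m by omega, ← two_mul, ← Nat.centralBinom_eq_two_mul_choose]
  refine Real.le_sqrt_of_sq_le ?_
  have h2 : (m.centralBinom : ℝ) ^ 2 * (2 * m + 1) ≤ 16 ^ m := by
    exact_mod_cast sq_centralBinom_mul_le m
  rw [mul_pow, div_pow, ← pow_mul, mul_comm m 2, pow_mul, show (4 : ℝ) ^ 2 = 16 by norm_num,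
    ← mul_div_assoc, div_le_iff₀ (by positivity)]
  nlinarith [mul_nonneg (sq_nonneg (m.centralBinom : ℝ)) (sq_nonneg (m : ℝ)),
    mul_nonneg (sq_nonneg (m.centralBinom : ℝ)) (Nat.cast_nonneg (α := ℝ) m),
    mul_le_mul_of_nonneg_left h2 (show (0 : ℝ) ≤ m + 1 by positivity)]

end BalancedSlice

/-! ### Asymptotics and the choice of c. -/

namespace BalancedSlice

open Finset Filter Topology

/-- With y = x^(δ/2), eventually x ≤ 2^y and y ≥ 3, so the exponents compare as y + 2y ≤ y². -/
theorem eventually_mul_two_rpow_le {δ : ℝ} (hδ : 0 < δ) :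
    ∀ᶠ x : ℝ in atTop, x * 2 ^ (2 * x ^ (δ / 2)) ≤ (2 : ℝ) ^ x ^ δ := by
  have hlog : ∀ᶠ x : ℝ in atTop, ‖Real.log x‖ ≤ Real.log 2 * ‖x ^ (δ / 2)‖ :=
    (isLittleO_log_rpow_atTop (half_pos hδ)).bound (Real.log_pos one_lt_two)
  filter_upwards [hlog, (tendsto_rpow_atTop (half_pos hδ)).eventually_ge_atTop 3,
    eventually_gt_atTop 0] with x h1 h2 hx
  have hsq : x ^ δ = x ^ (δ / 2) * x ^ (δ / 2) := by
    rw [← Real.rpow_add hx, add_halves]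
  rw [hsq]
  generalize x ^ (δ / 2) = y at h1 h2
  have h3 : x ≤ 2 ^ y := by
    rw [Real.norm_eq_abs, Real.norm_eq_abs, abs_of_nonneg (by linarith : 0 ≤ y)] at h1
    rw [Real.rpow_def_of_pos two_pos]
    exact (Real.le_exp_log x).trans (Real.exp_le_exp.2 ((le_abs_self _).trans h1))
  calc x * 2 ^ (2 * y) ≤ 2 ^ y * 2 ^ (2 * y) := by gcongr
    _ = (2 : ℝ) ^ (y + 2 * y) := (Real.rpow_add two_pos _ _).symm
    _ ≤ (2 : ℝ) ^ (y * y) := Real.rpow_le_rpow_of_exponent_le one_le_two (by nlinarith)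

theorem IsWalkEigenvalue.le_of_large_degree {n t : ℕ} {μ c δ : ℝ} (hμ : IsWalkEigenvalue n t μ)
    (hn : Even n) (hn2 : 2 ≤ n) (ht : t ≤ n / 2) (hδ : (n : ℝ) ^ δ < t) (hc : c ≤ δ / 2)
    (hlarge : (n : ℝ) * 2 ^ (2 * (n : ℝ) ^ (δ / 2)) ≤ (2 : ℝ) ^ (n : ℝ) ^ δ) :
    μ ≤ 1 / (2 : ℝ) ^ ((n : ℝ) ^ c) := by
  have hn1 : (1 : ℝ) ≤ n := by exact_mod_cast (by omega : 1 ≤ n)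
  have hpos : (0 : ℝ) < 2 ^ (n : ℝ) ^ c := by positivity
  have h1 : ((2 : ℝ) ^ (n : ℝ) ^ c) ^ 2 ≤ 2 ^ (2 * (n : ℝ) ^ (δ / 2)) := by
    rw [← Real.rpow_natCast, ← Real.rpow_mul two_pos.le, mul_comm]
    refine Real.rpow_le_rpow_of_exponent_le one_le_two ?_
    push_cast
    gcongr
  have h2 : μ ^ 2 ≤ n / (2 : ℝ) ^ (n : ℝ) ^ δ := by
    refine (hμ.sq_le hn ht).trans ?_
    rw [← Real.rpow_natCast]
    gcongr
    · exact_mod_cast (by omega : n / 2 + 1 ≤ n)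
    · exact one_le_two
  rw [le_div_iff₀ hpos]
  refine le_of_sq_le_sq ?_ zero_le_one
  rw [mul_pow, one_pow]
  calc μ ^ 2 * ((2 : ℝ) ^ (n : ℝ) ^ c) ^ 2
      ≤ n / (2 : ℝ) ^ (n : ℝ) ^ δ * 2 ^ (2 * (n : ℝ) ^ (δ / 2)) := by gcongr
    _ = n * 2 ^ (2 * (n : ℝ) ^ (δ / 2)) / (2 : ℝ) ^ (n : ℝ) ^ δ := by ring
    _ ≤ 1 := (div_le_one (by positivity)).2 hlarge

theorem pow_div_le_choose {m t : ℕ} (ht : 1 ≤ t) {a b : ℝ} (ha : 0 ≤ a)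
    (hm : a ≤ (m + 1 - t : ℕ)) (hb : (t : ℝ) ≤ b) : (a / b) ^ t ≤ m.choose t := by
  have ht' : (0 : ℝ) < t := by exact_mod_cast ht
  have hab := div_nonneg ha (ht'.le.trans hb)
  calc (a / b) ^ t ≤ ((m + 1 - t : ℕ) / (t : ℝ)) ^ t := by gcongr
    _ = ((m + 1 - t : ℕ) : ℝ) ^ t / (t : ℝ) ^ t := div_pow _ _ _
    _ ≤ ((m + 1 - t : ℕ) : ℝ) ^ t / (t.factorial : ℝ) := by
      gcongr
      exact_mod_cast Nat.factorial_le_pow t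
    _ ≤ m.choose t := Nat.pow_le_choose t m

/-- With y = n^(1/8) and t ≤ y, the binomial C(n/2, t) is at least (y^8/(4y))^t ≥ y^(6t), while
√(n/2+1) ≤ y^4 ≤ y^(4t). Hence μ² ≤ y^(-2t), and μ ≤ n^(-t/8). -/
theorem IsWalkEigenvalue.le_of_small_degree {n t : ℕ} {μ c δ : ℝ} (hμ : IsWalkEigenvalue n t μ)
    (hn : Even n) (ht0 : 1 ≤ t) (ht : t ≤ n / 2) (hδ : (t : ℝ) ≤ (n : ℝ) ^ δ) (hδ' : δ ≤ 1 / 8)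
    (hc : c ≤ 1 / 8) (hlarge : 4 ^ 8 ≤ n) : μ ≤ 1 / (n : ℝ) ^ (c * (t : ℝ)) := by
  have hn1 : (1 : ℝ) ≤ n := by exact_mod_cast (by omega : 1 ≤ n)
  set y : ℝ := (n : ℝ) ^ (1 / 8 : ℝ) with hy
  have hy8 : y ^ 8 = n := by
    rw [hy, ← Real.rpow_natCast, ← Real.rpow_mul (by linarith)]
    norm_num
  have hy0 : 0 < y := by positivity
  have hy4 : 4 ≤ y := by
    refine le_of_pow_le_pow_left₀ (n := 8) (by norm_num) hy0.le ?_
    rw [hy8]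
    exact_mod_cast hlarge
  have hty : (t : ℝ) ≤ y := hδ.trans (Real.rpow_le_rpow_of_exponent_le hn1 hδ')
  have hy7 : (4 : ℝ) ^ 7 ≤ y ^ 7 := pow_le_pow_left₀ (by norm_num) hy4 7
  have hm : y ^ 8 / 4 ≤ (n / 2 + 1 - t : ℕ) := by
    rw [Nat.cast_sub (by omega), Nat.cast_add, Nat.cast_div hn.two_dvd (by norm_num), ← hy8]
    push_cast
    have : y ^ 8 = y ^ 7 * y := by ring
    nlinarith
  have h6 : (y ^ 6) ^ t ≤ (n / 2).choose t := by
    refine le_trans ?_ (pow_div_le_choose ht0 (by positivity) hm hty)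
    refine pow_le_pow_left₀ (by positivity) ?_ t
    rw [le_div_iff₀ hy0, le_div_iff₀ (by norm_num)]
    have : y ^ 8 = y ^ 6 * y * y := by ring
    have : 0 < y ^ 6 * y := by positivity
    nlinarith
  have h4 : √((n / 2 : ℕ) + 1) ≤ (y ^ 4) ^ t := by
    have h1 : √((n / 2 : ℕ) + 1) ≤ y ^ 4 := by
      rw [Real.sqrt_le_left (by positivity), ← pow_mul, hy8]
      exact_mod_cast (by omega : n / 2 + 1 ≤ n)
    exact h1.trans (le_self_pow₀ (one_le_pow₀ (by linarith)) (by omega))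
  have hmul : (y ^ 4) ^ t * (μ * y ^ t) ^ 2 ≤ (y ^ 4) ^ t * 1 :=
    calc (y ^ 4) ^ t * (μ * y ^ t) ^ 2 = (y ^ 6) ^ t * μ ^ 2 := by ring
      _ ≤ (n / 2).choose t * μ ^ 2 := by gcongr
      _ ≤ (y ^ 4) ^ t * 1 := by rw [mul_one]; exact (hμ.choose_mul_sq_le hn ht).trans h4
  have hsq := le_of_mul_le_mul_left hmul (by positivity)
  have h1 : μ * y ^ t ≤ 1 := le_of_sq_le_sq (by rwa [one_pow]) zero_le_one
  rw [le_div_iff₀ (by positivity)]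
  by_cases hμ0 : μ ≤ 0
  · exact (mul_nonpos_of_nonpos_of_nonneg hμ0 (by positivity)).trans zero_le_one
  · refine (mul_le_mul_of_nonneg_left ?_ (not_le.1 hμ0).le).trans h1
    rw [hy, ← Real.rpow_natCast, ← Real.rpow_mul (by linarith)]
    gcongr

/-- As c tends to 0 the two bounds tend to 1 and to 1/2; the second limit is why a strict inequality
is needed. -/
theorem eventually_le_of_lt_half {n : ℕ} (hn : 1 ≤ n) (t : ℕ) {μ : ℝ} (hμ : μ < 1 / 2) :
    ∀ᶠ c : ℝ in 𝓝[>] 0, μ ≤ 1 / (n : ℝ) ^ (c * (t : ℝ)) ∧ μ ≤ 1 / (2 : ℝ) ^ ((n : ℝ) ^ c) := by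
  have hn0 : (0 : ℝ) < n := by exact_mod_cast hn
  have h1 : Tendsto (fun c : ℝ => 1 / (n : ℝ) ^ (c * (t : ℝ))) (𝓝 0)
      (𝓝 (1 / (n : ℝ) ^ (0 * (t : ℝ)))) :=
    tendsto_const_nhds.div ((Real.continuous_const_rpow hn0.ne').tendsto _ |>.comp
      ((continuous_mul_const (t : ℝ)).tendsto 0)) (by positivity)
  have h2 : Tendsto (fun c : ℝ => 1 / (2 : ℝ) ^ ((n : ℝ) ^ c)) (𝓝 0)
      (𝓝 (1 / (2 : ℝ) ^ ((n : ℝ) ^ (0 : ℝ)))) :=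
    tendsto_const_nhds.div ((Real.continuous_const_rpow two_ne_zero).tendsto _ |>.comp
      ((Real.continuous_const_rpow hn0.ne').tendsto 0)) (by positivity)
  refine nhdsWithin_le_nhds ?_
  filter_upwards [h1.eventually (lt_mem_nhds (show μ < _ by simp; linarith)),
    h2.eventually (lt_mem_nhds (show μ < _ by simpa using hμ))] with c hc1 hc2
  exact ⟨hc1.le, hc2.le⟩

/-- The eigenvalue of the walk on the `t`-th eigenspace of the Johnson scheme. -/
noncomputable def walkEigenvalue (n t : ℕ) : ℝ := Classical.epsilon (IsWalkEigenvalue n t)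

theorem isWalkEigenvalue_walkEigenvalue {n t : ℕ} (hn : Even n) (ht : t ≤ n / 2) :
    IsWalkEigenvalue n t (walkEigenvalue n t) :=
  Classical.epsilon_spec (exists_isWalkEigenvalue hn ht)

theorem exists_walkEigenvalue_bound {δ : ℝ} (hδ : 0 < δ) (hδ' : δ ≤ 1 / 8) :
    ∃ c : ℝ, 0 < c ∧ ∀ n t : ℕ, Even n → 1 ≤ t → t ≤ n / 2 →
      ((t : ℝ) ≤ (n : ℝ) ^ δ → walkEigenvalue n t ≤ 1 / (n : ℝ) ^ (c * (t : ℝ))) ∧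
      ((n : ℝ) ^ δ < (t : ℝ) → walkEigenvalue n t ≤ 1 / (2 : ℝ) ^ ((n : ℝ) ^ c)) := by
  obtain ⟨N, hN⟩ := eventually_atTop.1
    ((tendsto_natCast_atTop_atTop (R := ℝ)).eventually (eventually_mul_two_rpow_le hδ))
  -- Below the threshold there are only finitely many pairs (n, t), so one small c serves them all;
  -- above it, c ≤ 1/8 and c ≤ δ/2 suffice.
  have hsmall : ∀ᶠ c : ℝ in 𝓝[>] 0, ∀ n ∈ range (max N (4 ^ 8)), ∀ t ∈ range (n / 2 + 1),
      Even n → 1 ≤ t → walkEigenvalue n t ≤ 1 / (n : ℝ) ^ (c * (t : ℝ)) ∧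
        walkEigenvalue n t ≤ 1 / (2 : ℝ) ^ ((n : ℝ) ^ c) := by
    refine (eventually_all_finset _).2 fun n _ => (eventually_all_finset _).2 fun t ht => ?_
    simp only [eventually_imp_distrib_left]
    intro hn ht0
    have htn : t ≤ n / 2 := Nat.lt_succ_iff.1 (mem_range.1 ht)
    exact eventually_le_of_lt_half (by omega) t
      ((isWalkEigenvalue_walkEigenvalue hn htn).lt_half hn htn ht0)
  obtain ⟨c, ⟨hc, hc8, hcδ⟩, hc0⟩ := ((hsmall.and
    (((eventually_le_nhds (by norm_num : (0 : ℝ) < 1 / 8)).and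
      (eventually_le_nhds (half_pos hδ))).filter_mono nhdsWithin_le_nhds)).and
    self_mem_nhdsWithin).exists
  refine ⟨c, hc0, fun n t hn ht0 ht => ?_⟩
  rcases lt_or_ge n (max N (4 ^ 8)) with h | h
  · have := hc n (mem_range.2 h) t (mem_range.2 (Nat.lt_succ_of_le ht)) hn ht0
    exact ⟨fun _ => this.1, fun _ => this.2⟩
  · have hμ := isWalkEigenvalue_walkEigenvalue hn ht
    exact ⟨fun h1 => hμ.le_of_small_degree hn ht0 ht h1 hδ' hc8 ((le_max_right _ _).trans h),
      fun h1 => hμ.le_of_large_degree hn (by omega) ht h1 hcδ (hN n ((le_max_left _ _).trans h))⟩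

end BalancedSlice

theorem mainTheorem10 :
    ∃ δ₀ : ℝ, 0 < δ₀ ∧ ∀ δ : ℝ, 0 < δ → δ ≤ δ₀ →
      ∃ c : ℝ, 0 < c ∧ ∀ n : ℕ, Even n →
        -- the spaces are nonzero and decompose the functions on the slice orthogonally
        (∀ t : ℕ, t ≤ n / 2 → BalancedSlice.johnsonSpace n t ≠ ⊥) ∧
        (∀ s t : ℕ, s ≤ n / 2 → t ≤ n / 2 → s ≠ t →
          ∀ f ∈ BalancedSlice.johnsonSpace n s, ∀ g ∈ BalancedSlice.johnsonSpace n t,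
            ∑ x : BalancedSlice.Slice n, f x * g x = 0) ∧
        (⨆ t : Fin (n / 2 + 1), BalancedSlice.johnsonSpace n t) = ⊤ ∧
        -- the walk has an eigenvalue on each of them, and these are bounded as follows
        ∃ ev : ℕ → ℝ,
          (∀ t : ℕ, t ≤ n / 2 → ∀ f ∈ BalancedSlice.johnsonSpace n t,
            (BalancedSlice.walk n).mulVec f = ev t • f) ∧
          (∀ t : ℕ, 1 ≤ t → t ≤ n / 2 → (t : ℝ) ≤ (n : ℝ) ^ δ →
            ev t ≤ 1 / (n : ℝ) ^ (c * (t : ℝ))) ∧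
          (∀ t : ℕ, t ≤ n / 2 → (n : ℝ) ^ δ < (t : ℝ) →
            ev t ≤ 1 / (2 : ℝ) ^ ((n : ℝ) ^ c)) := by

  refine ⟨1 / 8, by norm_num, fun δ hδ hδ' => ?_⟩
  obtain ⟨c, hc, hbound⟩ := BalancedSlice.exists_walkEigenvalue_bound hδ hδ'
  refine ⟨c, hc, fun n hn => ⟨fun t ht => BalancedSlice.johnsonSpace_ne_bot hn ht,
    fun s t _ _ hst f hf g hg => BalancedSlice.sum_mul_eq_zero_of_ne hst hf hg,
    BalancedSlice.iSup_johnsonSpace hn, BalancedSlice.walkEigenvalue n,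
    fun t ht => BalancedSlice.isWalkEigenvalue_walkEigenvalue hn ht,
    fun t ht0 ht h => (hbound n t hn ht0 ht).1 h, fun t ht h => (hbound n t hn ?_ ht).2 h⟩⟩
  -- The second range excludes t = 0 automatically, since n^δ ≥ 0.
  have : (0 : ℝ) < t := (Real.rpow_nonneg n.cast_nonneg δ).trans_lt h
  exact_mod_cast this
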